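/- Let $(E,d)$ be a complete separable metric space with Borel $\sigma$-algebra $\mathcal B$, let $(\Omega,\mathcal F,P)$ be a probability space, and let $(\vartheta_t)_{t\in\mathbb R}$ be a metric dynamical system on it: $(t,\omega)\mapsto\vartheta_t\omega$ is measurable, $\vartheta_0=\mathrm{id}$, $\vartheta_{s+t}=\vartheta_s\circ\vartheta_t$, and every $\vartheta_t$ preserves $P$. Let $\varphi$ be a continuous random dynamical system over it, i.e. a measurable map $[0,\infty)\times\Omega\times E\to E$, $(t,\omega,x)\mapsto\varphi(t,\omega)x$, with $\varphi(0,\omega)=\mathrm{id}$ and $\varphi(t+s,\omega)=\varphi(t,\vartheta_s\omega)\circ\varphi(s,\omega)$ for all $s,t\ge 0$ and $\omega\in\Omega$, such that $\varphi(t,\omega):E\to E$ is continuous for all $t,\omega$. For $A,B\subseteq E$ put $d(A,B)=\sup_{a\in A}\inf_{b\in B}d(a,b)\in[0,\infty]$ (with $\sup\emptyset=0$, $\inf\emptyset=\infty$), and let $A^\delta=\{x\in E: \inf_{a\in A}d(x,a)\le\delta\}$ be the closed $\delta$-neighbourhood of $A$. A family $(A(\omega))_{\omega\in\Omega}$ of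 subsets of $E$ is said to attract all bounded sets if for every bounded $B\subseteq E$ $$\lim_{t\to\infty}d\bigl(\varphi(t,\vartheta_{-t}\omega)B,A(\omega)\bigr)=0\quad\text{for $P$-almost every }\omega .$$ A strong $B$-attractor is a family $(A(\omega))_{\omega\in\Omega}$ of compact subsets of $E$ such that $\omega\mapsto \inf_{a\in A(\omega)}d(x,a)$ is measurable for every $x\in E$, such that for $P$-almost every $\omega$ one has $\varphi(t,\omega)A(\omega)=A(\vartheta_t\omega)$ for all $t\ge 0$, and which attracts all bounded sets. Then the following are equivalent. (i) $\varphi$ has a strong $B$-attractor. (ii) For every $\varepsilon>0$ there is a compact set $C_\varepsilon\subseteq E$ such that for every $\delta>0$ and every bounded closed $B\subseteq E$ there is a $T>0$ with $$P\Bigl\{\omega:\ \bigcup_{t\ge T}\varphi(t,\vartheta_{-t}\omega)B\subseteq C_\varepsilon^{\delta}\Bigr\}\ge 1-\varepsilon ,$$ where $P$ also denotes its completion. (iii) There is a set $K\in\mathcal B\otimes\mathcal F$ (a random set), with sections $K(\omega)=\{x\in E:(x,\omega)\in K\}$, such that $K(\omega)$ is compact for $P$-almost every $\omega$ and $(K(\omega))_{\omega\in\Omega}$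 attracts all bounded sets. -/

import Mathlib

open MeasureTheory Filter Topology Set
open scoped NNReal ENNReal

namespace RandomAttractors

/-- A metric dynamical system with time `ℝ` on the probability space `(Ω, P)`: a jointly
measurable one-parameter group of `P`-preserving maps `ϑ t : Ω → Ω`. -/
structure MetricDynamicalSystem {Ω : Type*} [MeasurableSpace Ω] (P : Measure Ω) where
  /-- the shift `ϑ t` -/
  shift : ℝ → Ω → Ω
  measurable_shift : Measurable (fun p : ℝ × Ω => shift p.1 p.2)
  shift_zero : ∀ ω, shift 0 ω = ω
  shift_add : ∀ (s t : ℝ) (ω : Ω), shift (s + t) ω = shift s (shift t ω)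
  measurePreserving_shift : ∀ t, MeasurePreserving (shift t) P P

/-- A continuous random dynamical system on `E` over `ϑ`, with time `[0, ∞)`: a jointly measurable
cocycle `(t, ω, x) ↦ φ(t, ω) x` over `ϑ` such that every map `φ(t, ω) : E → E` is continuous. -/
structure ContinuousRDS {Ω : Type*} [MeasurableSpace Ω] {P : Measure Ω}
    (ϑ : MetricDynamicalSystem P) (E : Type*) [TopologicalSpace E] [MeasurableSpace E] where
  /-- the cocycle `φ(t, ω) x` -/
  flow : ℝ≥0 → Ω → E → E
  measurable_flow : Measurable (fun p : ℝ≥0 × Ω × E => flow p.1 p.2.1 p.2.2)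
  flow_zero : ∀ ω x, flow 0 ω x = x
  flow_add : ∀ (t s : ℝ≥0) (ω : Ω) (x : E),
    flow (t + s) ω x = flow t (ϑ.shift s ω) (flow s ω x)
  continuous_flow : ∀ t ω, Continuous (flow t ω)

/-- The Hausdorff semi-distance `d(A, B) = sup_{a ∈ A} inf_{b ∈ B} d(a, b)`, with values in
`[0, ∞]`; it is `0` if `A` is empty, and `∞` if `B` is empty and `A` is not. -/
noncomputable def semiDist {E : Type*} [PseudoEMetricSpace E] (A B : Set E) : ℝ≥0∞ :=
  ⨆ a ∈ A, Metric.infEDist a B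

/-- The `ω`-section `K(ω)` of a subset `K` of `E × Ω`. -/
def fiber {E Ω : Type*} (K : Set (E × Ω)) (ω : Ω) : Set E := {x | (x, ω) ∈ K}

/-- A compact random set: a map from `Ω` to the compact subsets of `E` all of whose distance
functions `ω ↦ d(x, A(ω))` are measurable. -/
structure IsCompactRandomSet {Ω E : Type*} [MeasurableSpace Ω] [PseudoEMetricSpace E]
    (A : Ω → Set E) : Prop where
  isCompact : ∀ ω, IsCompact (A ω)
  measurable_infEDist : ∀ x, Measurable (fun ω => Metric.infEDist x (A ω))

namespace ContinuousRDS

variable {Ω : Type*} [MeasurableSpace Ω] {P : Measure Ω} {ϑ : MetricDynamicalSystem P}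
  {E : Type*} [MetricSpace E] [MeasurableSpace E]

/-- The pullback image `φ(t, ϑ_{-t} ω) B`. -/
def pullback (φ : ContinuousRDS ϑ E) (t : ℝ≥0) (ω : Ω) (B : Set E) : Set E :=
  φ.flow t (ϑ.shift (-(t : ℝ)) ω) '' B

/-- `A` pullback-attracts every bounded set almost surely (the exceptional null set may depend on
the bounded set). -/
def AttractsBounded (φ : ContinuousRDS ϑ E) (A : Ω → Set E) : Prop :=
  ∀ B : Set E, Bornology.IsBounded B →
    ∀ᵐ ω ∂P, Tendsto (fun t : ℝ≥0 => semiDist (φ.pullback t ω B) (A ω)) atTop (𝓝 0)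

/-- A strong `B`-attractor: a compact random set that is strictly invariant almost surely and
pullback-attracts every bounded set almost surely. -/
structure IsStrongBAttractor (φ : ContinuousRDS ϑ E) (A : Ω → Set E) : Prop where
  isCompactRandomSet : IsCompactRandomSet A
  invariant : ∀ᵐ ω ∂P, ∀ t : ℝ≥0, φ.flow t ω '' A ω = A (ϑ.shift t ω)
  attracts : φ.AttractsBounded A

end ContinuousRDS

end RandomAttractors

/-! (i) gives (iii) by taking the graph. For (iii) ⇒ (ii), a random set with compact sections is
tight: up to probability ε/2 it lies in one deterministic compact C, and attraction pulls the tails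
into every neighbourhood of C. For (ii) ⇒ (i), let A(ω) be the closure of the union of the pullback
limit sets of the balls of integer radius about a point. By (ii), almost every ω has one compact set
attracting all these balls; for such ω, compactness, strict invariance and attraction are
deterministic facts about cluster points of the filter of tails.

Measurability is the hard part. Tails are uncountable unions, so the projection theorem makes their
events measurable only for the completion, and the distance functions of A only a.e. measurable.
Restricting A to a measurable set H of full measure repairs this but may destroy invariance. The
remedy is `aeOrbit H`, which is measurable, exactly shift-invariant and of full measure. On it,
invariance writes d(x, A(ω)) as the average over t in [0,1] of d(x, φ(t, ϑ_{-t}ω) A(ϑ_{-t}ω)), where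
A is evaluated on H for almost every t; Fubini then gives genuine measurability. -/

namespace RandomAttractors

/-! ### Analytic sets and measurable projection -/

/-- A measurable subset of a product `X × Ω` depends on the second coordinate only through a
measurable map into the Cantor space. -/
theorem exists_measurable_cantor_factorization {X Ω : Type*} [MeasurableSpace X]
    [MeasurableSpace Ω] {s : Set (X × Ω)} (hs : MeasurableSet s) :
    ∃ g : Ω → ℕ → Bool, Measurable g ∧ ∃ s' : Set (X × (ℕ → Bool)), MeasurableSet s' ∧
      s = (fun p : X × Ω => (p.1, g p.2)) ⁻¹' s' := by
  classical
  rw [← generateFrom_prod] at hs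
  induction s, hs using MeasurableSpace.generateFrom_induction with
  | hC t ht _ =>
    obtain ⟨u, hu, v, hv, rfl⟩ := ht
    refine ⟨fun ω _ => decide (ω ∈ v), ?_, u ×ˢ {z | z 0 = true}, ?_, ?_⟩
    · exact measurable_pi_lambda _ fun _ => measurable_to_bool (by
        simpa [preimage] using (show MeasurableSet v from hv))
    · exact MeasurableSet.prod hu (measurableSet_eq_fun (measurable_pi_apply 0) measurable_const)
    · ext ⟨x, ω⟩; simp
  | empty => exact ⟨fun _ _ => true, measurable_const, ∅, .empty, by simp⟩
  | compl t _ ih =>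
    obtain ⟨g, hg, s', hs', rfl⟩ := ih
    exact ⟨g, hg, s'ᶜ, hs'.compl, rfl⟩
  | iUnion t _ ih =>
    choose g hg s' hs' h using ih
    -- Countably many Cantor codes are interleaved into one through the pairing ℕ × ℕ ≃ ℕ.
    refine ⟨fun ω k => g k.unpair.1 ω k.unpair.2, ?_,
      ⋃ n, (fun p : X × (ℕ → Bool) => (p.1, fun j => p.2 (Nat.pair n j))) ⁻¹' s' n, ?_, ?_⟩
    · exact measurable_pi_lambda _ fun k => (measurable_pi_apply _).comp (hg _)
    · refine MeasurableSet.iUnion fun n => ?_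
      have : Measurable (fun p : X × (ℕ → Bool) => (p.1, fun j => p.2 (Nat.pair n j))) :=
        measurable_fst.prodMk (measurable_pi_lambda _ fun j =>
          (measurable_pi_apply _).comp measurable_snd)
      exact this (hs' n)
    · rw [preimage_iUnion]
      refine iUnion_congr fun n => ?_
      rw [h n]
      ext ⟨x, ω⟩
      simp

/-- The points of the Baire space bounded by `b` in the coordinates `< k`. -/
def baireBox (b : ℕ → ℕ) (k : ℕ) : Set (ℕ → ℕ) := {x | ∀ i < k, x i ≤ b i}

theorem isCompact_baire_Iic (b : ℕ → ℕ) : IsCompact {x : ℕ → ℕ | ∀ i, x i ≤ b i} := by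
  have : {x : ℕ → ℕ | ∀ i, x i ≤ b i} = Set.pi univ fun i => Iic (b i) := by
    ext; simp [Pi.le_def]
  rw [this]
  exact isCompact_univ_pi fun i => (finite_Iic _).isCompact

/-- The boxes `baireBox b k` shrink to a compact set in the topology of the Baire space. -/
theorem exists_baireBox_subset {b : ℕ → ℕ} {U : Set (ℕ → ℕ)} (hU : IsOpen U)
    (h : {x : ℕ → ℕ | ∀ i, x i ≤ b i} ⊆ U) : ∃ k, baireBox b k ⊆ U := by
  by_contra! hne
  choose x hx using fun k => not_subset.1 (hne k)
  -- Truncation moves the points into the compact set without changing the coordinates below `k`, so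
  -- limits are unaffected.
  set y : ℕ → ℕ → ℕ := fun k i => min (x k i) (b i)
  obtain ⟨z, hz, ψ, hψ, hlim⟩ := (isCompact_baire_Iic b).tendsto_subseq
    (x := y) (fun k i => min_le_right _ _)
  have hlim' : Tendsto (x ∘ ψ) atTop (𝓝 z) := by
    rw [tendsto_pi_nhds] at hlim ⊢
    intro i
    refine (hlim i).congr' ?_
    filter_upwards [eventually_gt_atTop i] with k hk
    exact min_eq_left ((hx (ψ k)).1 i (hk.trans_le hψ.le_apply))
  obtain ⟨k, hk⟩ := (hlim'.eventually (hU.mem_nhds (h hz))).exists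
  exact (hx (ψ k)).2 hk

/-- Analytic sets are measurable for the completion of every finite Borel measure. -/
theorem nullMeasurableSet_of_analyticSet {Y : Type*} [TopologicalSpace Y] [T2Space Y]
    [RegularSpace Y] [MeasurableSpace Y] [BorelSpace Y] (μ : Measure Y) [IsFiniteMeasure μ]
    {s : Set Y} (hs : AnalyticSet s) : NullMeasurableSet s μ := by
  rw [AnalyticSet] at hs
  rcases hs with rfl | ⟨f, hf, rfl⟩
  · exact .empty
  have key : ∀ ε : ℝ≥0∞, 0 < ε → ∃ K ⊆ range f, IsCompact K ∧ μ (range f) ≤ μ K + ε := by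
    intro ε hε
    obtain ⟨e, he0, hesum⟩ := ENNReal.exists_pos_sum_of_countable' hε.ne' ℕ
    -- Continuity from below holds for the outer measure of arbitrary increasing sets, so bounding
    -- one coordinate costs at most `e k`, with no measurability of the images.
    have step : ∀ (k : ℕ) (S : Set (ℕ → ℕ)), ∃ n : ℕ,
        μ (f '' S) ≤ μ (f '' (S ∩ {x | x k ≤ n})) + e k := by
      intro k S
      have hU : f '' S = ⋃ n : ℕ, f '' (S ∩ {x | x k ≤ n}) := by
        rw [← image_iUnion, ← inter_iUnion]
        congr 1
        refine (inter_eq_left.2 fun x _ => mem_iUnion.2 ⟨x k, by simp⟩).symm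
      have hm : Monotone fun n : ℕ => f '' (S ∩ {x | x k ≤ n}) := fun a b hab =>
        image_mono (inter_subset_inter_right _ fun x (hx : _ ≤ _) => hx.trans hab)
      have ht := tendsto_measure_iUnion_atTop (μ := μ) hm
      rw [← hU] at ht
      have h2 := ht.add_const (e k)
      by_contra! hcon
      have h3 := le_of_tendsto h2 (Eventually.of_forall fun n => (hcon n).le)
      have : μ (f '' S) < μ (f '' S) + e k :=
        ENNReal.lt_add_right (measure_ne_top _ _) (he0 k).ne'
      exact absurd h3 this.not_ge
    choose N hN using step
    let T : ℕ → Set (ℕ → ℕ) := fun k => Nat.rec univ (fun k S => S ∩ {x | x k ≤ N k S}) k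
    let b : ℕ → ℕ := fun k => N k (T k)
    have hT : ∀ k, T k = baireBox b k := by
      intro k
      induction k with
      | zero => simp [T, baireBox]
      | succ k ih =>
        change T k ∩ {x | x k ≤ b k} = _
        rw [ih]
        ext x
        simp only [baireBox, mem_inter_iff, mem_ofPred_eq, Nat.lt_succ_iff_lt_or_eq]
        grind
    have hbd : ∀ k, μ (range f) ≤ μ (f '' T k) + ∑ i ∈ Finset.range k, e i := by
      intro k
      induction k with
      | zero => simp [T]
      | succ k ih =>
        rw [Finset.sum_range_succ, add_comm (∑ i ∈ _, e i), ← add_assoc]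
        exact ih.trans (by gcongr; exact hN k (T k))
    have hK : IsCompact (f '' {x : ℕ → ℕ | ∀ i, x i ≤ b i}) := (isCompact_baire_Iic b).image hf
    refine ⟨_, image_subset_range _ _, hK, ?_⟩
    have hall : ∀ k, μ (range f) ≤ μ (closure (f '' baireBox b k)) + ε := by
      intro k
      refine (hbd k).trans ?_
      rw [hT]
      gcongr
      · exact subset_closure
      · exact (ENNReal.sum_le_tsum _).trans hesum.le
    -- Closures make the approximating sets measurable for continuity from above. They add nothing
    -- in the limit: a point off the compact image is separated from it by open sets, and some box
    -- already maps into the other one.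
    have hint : ⋂ k, closure (f '' baireBox b k) = f '' {x : ℕ → ℕ | ∀ i, x i ≤ b i} := by
      apply Subset.antisymm
      · intro y hy
        by_contra hyK
        obtain ⟨U, V, hUo, hVo, hKU, hyV, hUV⟩ := hK.separation_of_notMem hyK
        obtain ⟨k, hk⟩ := exists_baireBox_subset (b := b) (hUo.preimage hf)
          (image_subset_iff.1 hKU)
        have h1 := mem_iInter.1 hy k
        obtain ⟨w, hwV, hw⟩ := mem_closure_iff.1 h1 V hVo hyV
        exact disjoint_left.1 hUV (image_subset_iff.2 hk hw) hwV
      · exact subset_iInter fun k => (image_mono fun x hx => by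
            simp only [baireBox, mem_ofPred_eq] at hx ⊢; exact fun i _ => hx i).trans subset_closure
    have hanti : Antitone fun k => closure (f '' baireBox b k) := fun k l hkl =>
      closure_mono (image_mono fun x hx => by
        simp only [baireBox, mem_ofPred_eq] at hx ⊢; exact fun i hi => hx i (hi.trans_le hkl))
    have ht := tendsto_measure_iInter_atTop (μ := μ)
      (fun k => (isClosed_closure (s := f '' baireBox b k)).measurableSet.nullMeasurableSet)
      hanti ⟨0, measure_ne_top _ _⟩
    rw [hint] at ht
    exact ge_of_tendsto (ht.add_const ε) (Eventually.of_forall hall)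
  choose K hKs hKc hKμ using fun n : ℕ => key ((n : ℝ≥0∞) + 1)⁻¹
    (ENNReal.inv_pos.2 (by finiteness))
  have hmeas : MeasurableSet (⋃ n, K n) := .iUnion fun n => (hKc n).measurableSet
  have hsub : (⋃ n, K n) ⊆ range f := iUnion_subset hKs
  have hle : μ (range f) ≤ μ (⋃ n, K n) := by
    refine ENNReal.le_of_forall_pos_le_add fun ε hε _ => ?_
    obtain ⟨n, hn⟩ := ENNReal.exists_inv_nat_lt (a := (ε : ℝ≥0∞)) (by simpa using hε.ne')
    refine (hKμ n).trans ?_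
    gcongr
    · exact subset_iUnion K n
    · exact (ENNReal.inv_le_inv.2 le_self_add).trans hn.le
  have hae := ae_eq_of_subset_of_measure_ge hsub hle hmeas.nullMeasurableSet (measure_ne_top _ _)
  exact hmeas.nullMeasurableSet.congr hae

/-- **Measurable projection theorem**: the projection to `Ω` of a measurable subset of `X × Ω`,
with `X` standard Borel, is measurable for the completion of every finite measure. -/
theorem nullMeasurableSet_image_snd {X Ω : Type*} [MeasurableSpace X] [StandardBorelSpace X]
    [MeasurableSpace Ω] (μ : Measure Ω) [IsFiniteMeasure μ] {s : Set (X × Ω)}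
    (hs : MeasurableSet s) : NullMeasurableSet (Prod.snd '' s) μ := by
  obtain ⟨g, hg, s', hs', rfl⟩ := exists_measurable_cantor_factorization hs
  have h1 : Prod.snd '' ((fun p : X × Ω => (p.1, g p.2)) ⁻¹' s') = g ⁻¹' (Prod.snd '' s') := by
    ext ω; simp
  rw [h1]
  -- `Ω` is arbitrary, but in the Cantor space the projection is analytic, hence null measurable for
  -- the law of `g`.
  refine NullMeasurableSet.preimage (nullMeasurableSet_of_analyticSet (μ.map g) ?_)
    (hg.measurePreserving μ).quasiMeasurePreserving
  exact hs'.analyticSet_image measurable_snd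

/-! ### Cluster sets of filters converging to a compact set -/

/-- The set of cluster points of a filter. -/
def clusterSet {X : Type*} [TopologicalSpace X] (F : Filter X) : Set X := {x | ClusterPt x F}

/-- An ultrafilter converging to a compact set converges to one of its points. -/
theorem _root_.IsCompact.exists_le_nhds_of_le_nhdsSet {X : Type*} [TopologicalSpace X]
    {C : Set X} (hC : IsCompact C) {U : Ultrafilter X} (hU : (U : Filter X) ≤ 𝓝ˢ C) :
    ∃ x ∈ C, (U : Filter X) ≤ 𝓝 x := by
  by_contra! h
  have h1 : Disjoint (𝓝ˢ C) (U : Filter X) := hC.disjoint_nhdsSet_left.2 fun x hx =>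
    (Ultrafilter.disjoint_iff_not_le.2 (h x hx)).symm
  exact U.neBot.ne (disjoint_self.1 (h1.mono_left hU))

theorem clusterSet_subset_of_le_nhdsSet {X : Type*} [TopologicalSpace X] [T2Space X] {C : Set X}
    (hC : IsCompact C) {F : Filter X} (hF : F ≤ 𝓝ˢ C) : clusterSet F ⊆ C := by
  intro x hx
  obtain ⟨U, hU, hUx⟩ := clusterPt_iff_ultrafilter.1 (show ClusterPt x F from hx)
  obtain ⟨y, hy, hUy⟩ := hC.exists_le_nhds_of_le_nhdsSet (hU.trans hF)
  rwa [eq_of_nhds_neBot (U.neBot.mono (le_inf hUx hUy))]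

/-- Every ultrafilter finer than `F` converges to a point of `C`, and that point is a cluster point
of `F`. This is why limit sets attract. -/
theorem le_nhdsSet_clusterSet {X : Type*} [TopologicalSpace X] {C : Set X}
    (hC : IsCompact C) {F : Filter X} (hF : F ≤ 𝓝ˢ C) : F ≤ 𝓝ˢ (clusterSet F) := by
  refine le_iff_ultrafilter.2 fun U hU => ?_
  obtain ⟨x, -, hx⟩ := hC.exists_le_nhds_of_le_nhdsSet (hU.trans hF)
  exact hx.trans (nhds_le_nhdsSet (clusterPt_iff_ultrafilter.2 ⟨U, hU, hx⟩))

/-- A cluster point of the image lifts to an ultrafilter finer than `F`, which converges because of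
`C`. This is the source of strict invariance. -/
theorem clusterSet_map {X Y : Type*} [TopologicalSpace X] [TopologicalSpace Y] [T2Space Y]
    {C : Set X} (hC : IsCompact C) {F : Filter X} (hF : F ≤ 𝓝ˢ C) {f : X → Y}
    (hf : Continuous f) : clusterSet (map f F) = f '' clusterSet F := by
  apply Subset.antisymm
  · intro y hy
    have h1 : (F ⊓ comap f (𝓝 y)).NeBot := by
      have : (𝓝 y ⊓ map f F).NeBot := hy
      rwa [inf_comm, ← Filter.push_pull, map_neBot_iff] at this
    obtain ⟨U, hU⟩ := Ultrafilter.exists_le (F ⊓ comap f (𝓝 y))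
    obtain ⟨x, -, hx⟩ := hC.exists_le_nhds_of_le_nhdsSet ((hU.trans inf_le_left).trans hF)
    refine ⟨x, clusterPt_iff_ultrafilter.2 ⟨U, hU.trans inf_le_left, hx⟩, ?_⟩
    have h2 : Tendsto f U (𝓝 y) := tendsto_iff_comap.2 (hU.trans inf_le_right)
    exact tendsto_nhds_unique ((hf.tendsto x).mono_left hx) h2
  · rintro _ ⟨x, hx, rfl⟩
    exact ClusterPt.map (show ClusterPt x F from hx) hf.continuousAt tendsto_map

theorem map_le_nhdsSet_image {X Y : Type*} [TopologicalSpace X] [TopologicalSpace Y]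
    {C : Set X} {F : Filter X} (hF : F ≤ 𝓝ˢ C) {f : X → Y}
    (hf : Continuous f) : map f F ≤ 𝓝ˢ (f '' C) :=
  (map_mono hF).trans (hf.tendsto_nhdsSet (mapsTo_image f C))

/-! ### Invariant measurable sets of full measure -/

namespace MetricDynamicalSystem

variable {Ω : Type*} [MeasurableSpace Ω] {P : Measure Ω} (ϑ : MetricDynamicalSystem P)

theorem shift_neg_shift (t : ℝ) (ω : Ω) : ϑ.shift (-t) (ϑ.shift t ω) = ω := by
  rw [← ϑ.shift_add, neg_add_cancel, ϑ.shift_zero]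

theorem shift_shift_neg (t : ℝ) (ω : Ω) : ϑ.shift t (ϑ.shift (-t) ω) = ω := by
  rw [← ϑ.shift_add, add_neg_cancel, ϑ.shift_zero]

/-- The set of points whose orbit lies in `H` at Lebesgue-almost every time. -/
def aeOrbit (H : Set Ω) : Set Ω := {ω | ∀ᵐ t : ℝ, ϑ.shift t ω ∈ H}

theorem measurableSet_aeOrbit {H : Set Ω} (hH : MeasurableSet H) :
    MeasurableSet (ϑ.aeOrbit H) := by
  have h1 : MeasurableSet {p : Ω × ℝ | ϑ.shift p.2 p.1 ∈ Hᶜ} :=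
    (ϑ.measurable_shift.comp measurable_swap) hH.compl
  exact measurableSet_eq_fun (measurable_measure_prodMk_left (ν := (volume : Measure ℝ)) h1)
    measurable_const

/-- Translation invariance of Lebesgue measure. Asking for almost every time instead of every time
gives exact invariance while avoiding an uncountable intersection. -/
theorem shift_mem_aeOrbit {H : Set Ω} {ω : Ω} (h : ω ∈ ϑ.aeOrbit H) (s : ℝ) :
    ϑ.shift s ω ∈ ϑ.aeOrbit H := by
  have h1 : ∀ᵐ t : ℝ, ϑ.shift t ω ∈ H := h
  have h2 := (measurePreserving_add_right (volume : Measure ℝ) s).quasiMeasurePreserving.ae h1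
  change ∀ᵐ t : ℝ, ϑ.shift t (ϑ.shift s ω) ∈ H
  filter_upwards [h2] with t ht
  rwa [← ϑ.shift_add]

theorem ae_mem_aeOrbit [SFinite P] {H : Set Ω} (hH : MeasurableSet H) (hae : ∀ᵐ ω ∂P, ω ∈ H) :
    ∀ᵐ ω ∂P, ω ∈ ϑ.aeOrbit H := by
  have h1 : MeasurableSet {p : ℝ × Ω | ϑ.shift p.1 p.2 ∈ H} := ϑ.measurable_shift hH
  have h2 : ∀ᵐ t : ℝ, ∀ᵐ ω ∂P, ϑ.shift t ω ∈ H := Eventually.of_forall fun t =>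
    (ϑ.measurePreserving_shift t).quasiMeasurePreserving.ae hae
  exact (Measure.ae_ae_comm (p := fun (t : ℝ) ω => ϑ.shift t ω ∈ H) h1).1 h2

/-- Along negative times, too, the orbit of a point of `aeOrbit H` lies in `H` almost always. -/
theorem ae_shift_neg_mem {H : Set Ω} {ω : Ω} (h : ω ∈ ϑ.aeOrbit H) :
    ∀ᵐ t : ℝ, ϑ.shift (-t) ω ∈ H :=
  (Measure.measurePreserving_neg (volume : Measure ℝ)).quasiMeasurePreserving.ae
    (show ∀ᵐ t : ℝ, ϑ.shift t ω ∈ H from h)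

theorem exists_nonneg_shift_neg_mem {H : Set Ω} {ω : Ω} (h : ω ∈ ϑ.aeOrbit H) :
    ∃ t : ℝ≥0, ϑ.shift (-(t : ℝ)) ω ∈ H := by
  have h1 := ϑ.ae_shift_neg_mem h
  have h2 : ∃ᵐ t : ℝ, t ∈ Icc (0 : ℝ) 1 := by
    rw [frequently_ae_mem_iff]; simp
  obtain ⟨t, ht, htH⟩ := (h2.and_eventually h1).exists
  exact ⟨⟨t, ht.1⟩, htH⟩

end MetricDynamicalSystem

/-! ### Tails of pullback orbits -/

namespace ContinuousRDS

variable {Ω : Type*} [MeasurableSpace Ω] {P : Measure Ω} {ϑ : MetricDynamicalSystem P}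
  {E : Type*} [MetricSpace E] [MeasurableSpace E] (φ : ContinuousRDS ϑ E)

theorem measurable_pullbackMap :
    Measurable fun p : ℝ≥0 × Ω × E => φ.flow p.1 (ϑ.shift (-(p.1 : ℝ)) p.2.1) p.2.2 := by
  have h1 : Measurable fun p : ℝ≥0 × Ω × E => ϑ.shift (-(p.1 : ℝ)) p.2.1 :=
    ϑ.measurable_shift.comp
      ((measurable_coe_nnreal_real.comp measurable_fst).neg.prodMk
        (measurable_fst.comp measurable_snd))
  exact φ.measurable_flow.comp
    (measurable_fst.prodMk (h1.prodMk (measurable_snd.comp measurable_snd)))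

/-- The union of the pullback images of `B` at times `≥ T`. -/
def tail (T : ℝ≥0) (ω : Ω) (B : Set E) : Set E := ⋃ t ≥ T, φ.pullback t ω B

theorem mem_tail {T : ℝ≥0} {ω : Ω} {B : Set E} {y : E} :
    y ∈ φ.tail T ω B ↔ ∃ t ≥ T, ∃ b ∈ B, φ.flow t (ϑ.shift (-(t : ℝ)) ω) b = y := by
  simp [tail, pullback]

theorem tail_anti {S T : ℝ≥0} (h : S ≤ T) (ω : Ω) (B : Set E) :
    φ.tail T ω B ⊆ φ.tail S ω B :=
  biUnion_subset_biUnion_left fun _ ht => h.trans ht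

theorem tail_mono (T : ℝ≥0) (ω : Ω) {B B' : Set E} (h : B ⊆ B') :
    φ.tail T ω B ⊆ φ.tail T ω B' :=
  iUnion₂_mono fun _ _ => image_mono h

theorem pullback_subset_tail {T t : ℝ≥0} (h : T ≤ t) (ω : Ω) (B : Set E) :
    φ.pullback t ω B ⊆ φ.tail T ω B :=
  subset_biUnion_of_mem (u := fun t => φ.pullback t ω B) h

/-- The filter generated by the tails of the pullback orbit of `B`. -/
def tailFilter (ω : Ω) (B : Set E) : Filter E :=
  map (fun p : ℝ≥0 × E => φ.flow p.1 (ϑ.shift (-(p.1 : ℝ)) ω) p.2) (atTop ×ˢ 𝓟 B)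

theorem hasBasis_tailFilter (ω : Ω) (B : Set E) :
    (φ.tailFilter ω B).HasBasis (fun _ : ℝ≥0 => True) fun T => φ.tail T ω B := by
  have h := ((atTop_basis (α := ℝ≥0)).prod (hasBasis_principal B)).map
    fun p : ℝ≥0 × E => φ.flow p.1 (ϑ.shift (-(p.1 : ℝ)) ω) p.2
  refine ⟨fun s => ?_⟩
  have himg : ∀ T : ℝ≥0, (fun p : ℝ≥0 × E => φ.flow p.1 (ϑ.shift (-(p.1 : ℝ)) ω) p.2) ''
      (Ici T ×ˢ B) = φ.tail T ω B := by
    intro T; ext y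
    simp only [mem_image, Prod.exists, mem_prod, mem_Ici, mem_tail]
    grind
  rw [tailFilter, h.mem_iff]
  simp [himg]

theorem tail_mem_tailFilter (T : ℝ≥0) (ω : Ω) (B : Set E) :
    φ.tail T ω B ∈ φ.tailFilter ω B :=
  (φ.hasBasis_tailFilter ω B).mem_of_mem trivial

/-- By the cocycle property, pulling back over time `s + t` to the fibre of ϑ_s ω is pulling back
over time `t` to that of `ω`, then flowing for time `s`. -/
theorem tailFilter_shift (s : ℝ≥0) (ω : Ω) (B : Set E) :
    φ.tailFilter (ϑ.shift s ω) B = map (φ.flow s ω) (φ.tailFilter ω B) := by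
  have hflow : ∀ (t : ℝ≥0) (b : E),
      φ.flow (s + t) (ϑ.shift (-((s + t : ℝ≥0) : ℝ)) (ϑ.shift s ω)) b
        = φ.flow s ω (φ.flow t (ϑ.shift (-(t : ℝ)) ω) b) := by
    intro t b
    have h1 : ϑ.shift (-((s + t : ℝ≥0) : ℝ)) (ϑ.shift s ω) = ϑ.shift (-(t : ℝ)) ω := by
      rw [← ϑ.shift_add]
      congr 1
      push_cast
      ring
    rw [h1, φ.flow_add, ϑ.shift_shift_neg]
  refine (φ.hasBasis_tailFilter _ B).ext ((φ.hasBasis_tailFilter ω B).map _) ?_ ?_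
  · refine fun T _ => ⟨T, trivial, ?_⟩
    rintro _ ⟨y, hy, rfl⟩
    obtain ⟨t, ht, b, hb, rfl⟩ := φ.mem_tail.1 hy
    exact φ.mem_tail.2 ⟨s + t, ht.trans le_add_self, b, hb, hflow t b⟩
  · refine fun T _ => ⟨s + T, trivial, ?_⟩
    intro y hy
    obtain ⟨t, ht, b, hb, rfl⟩ := φ.mem_tail.1 hy
    obtain ⟨r, rfl⟩ := exists_add_of_le ((le_self_add : s ≤ s + T).trans ht)
    exact ⟨_, φ.mem_tail.2 ⟨r, by simpa using ht, b, hb, rfl⟩, (hflow r b).symm⟩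

end ContinuousRDS

/-! ### Graphs and tightness of random sets -/

/-- The graph of a compact random set is measurable. -/
theorem IsCompactRandomSet.measurableSet_graph {Ω E : Type*} [MeasurableSpace Ω] [MetricSpace E]
    [SecondCountableTopology E] [MeasurableSpace E] [BorelSpace E] {A : Ω → Set E}
    (hA : IsCompactRandomSet A) : MeasurableSet {p : E × Ω | p.1 ∈ A p.2} := by
  have h1 : Measurable (Function.uncurry fun (x : E) ω => Metric.infEDist x (A ω)) :=
    measurable_uncurry_of_continuous_of_measurable (fun _ => Metric.continuous_infEDist)
      hA.measurable_infEDist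
  have h2 : {p : E × Ω | p.1 ∈ A p.2}
      = (Function.uncurry fun (x : E) ω => Metric.infEDist x (A ω)) ⁻¹' {0} := by
    ext ⟨x, ω⟩
    have := (hA.isCompact ω).isClosed
    simp only [mem_ofPred_eq, mem_preimage, Function.uncurry, mem_singleton_iff]
    rw [← Metric.mem_closure_iff_infEDist_zero, this.closure_eq]
  rw [h2]
  exact h1 (measurableSet_singleton 0)

/-- A random set with almost surely compact sections in a complete separable space is tight. -/
theorem exists_isCompact_fiber_subset {Ω E : Type*} [MeasurableSpace Ω] (P : Measure Ω)
    [IsFiniteMeasure P] [MetricSpace E] [CompleteSpace E] [SecondCountableTopology E]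
    [MeasurableSpace E] [BorelSpace E] {K : Set (E × Ω)} (hK : MeasurableSet K)
    (hKc : ∀ᵐ ω ∂P, IsCompact (fiber K ω)) {ε : ℝ≥0∞} (hε : ε ≠ 0) :
    ∃ C : Set E, IsCompact C ∧ P {ω | ¬ fiber K ω ⊆ C} ≤ ε := by
  rcases isEmpty_or_nonempty E with hE | hE
  · refine ⟨∅, isCompact_empty, ?_⟩
    simp [eq_empty_of_isEmpty]
  obtain ⟨e, he0, hesum⟩ := ENNReal.exists_pos_sum_of_countable' hε ℕ
  let x := TopologicalSpace.denseSeq E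
  -- For each `n`, compact fibres lie in `D n m` for large `m`; choosing `m n` with error `e n`
  -- makes the intersection of the `D n (m n)` closed and totally bounded.
  let D : ℕ → ℕ → Set E := fun n m => ⋃ i ∈ Finset.range m, Metric.closedBall (x i) (1 / (n + 1))
  have hDclosed : ∀ n m, IsClosed (D n m) := fun n m =>
    (Finset.range m).finite_toSet.isClosed_biUnion fun _ _ => Metric.isClosed_closedBall
  have hnull : ∀ n m, NullMeasurableSet {ω | ¬ fiber K ω ⊆ D n m} P := by
    intro n m
    have h := nullMeasurableSet_image_snd P
      (hK.inter (measurable_fst (hDclosed n m).measurableSet.compl))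
    convert h using 1
    ext ω
    simp [not_subset, fiber]
  have hanti : ∀ n, Antitone fun m => {ω | ¬ fiber K ω ⊆ D n m} := by
    intro n a b hab ω hω hsub
    exact hω (hsub.trans (biUnion_subset_biUnion_left fun i hi =>
      Finset.mem_range.2 ((Finset.mem_range.1 hi).trans_le hab)))
  have hzero : ∀ n, P (⋂ m, {ω | ¬ fiber K ω ⊆ D n m}) = 0 := by
    intro n
    refine measure_mono_null (fun ω hω => ?_) hKc
    intro hcomp
    have hr : (0 : ℝ) < 1 / (n + 1) := by positivity
    have hmono : Monotone fun m => ⋃ i ∈ Finset.range m, Metric.ball (x i) (1 / ((n : ℝ) + 1)) :=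
      fun a b hab => biUnion_subset_biUnion_left fun i hi =>
        Finset.mem_range.2 ((Finset.mem_range.1 hi).trans_le hab)
    obtain ⟨m, hm⟩ := (show IsCompact (fiber K ω) from hcomp).elim_directed_cover
      (fun m => ⋃ i ∈ Finset.range m, Metric.ball (x i) (1 / ((n : ℝ) + 1)))
      (fun m => isOpen_biUnion fun _ _ => Metric.isOpen_ball)
      (fun y _ => by
        obtain ⟨i, hi⟩ := (TopologicalSpace.denseRange_denseSeq E).exists_dist_lt y hr
        simp only [mem_iUnion]
        exact ⟨i + 1, i, by simp, hi⟩)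
      hmono.directed_le
    exact mem_iInter.1 hω m (hm.trans (iUnion₂_mono fun _ _ => Metric.ball_subset_closedBall))
  have hchoose : ∀ n, ∃ m, P {ω | ¬ fiber K ω ⊆ D n m} < e n := by
    intro n
    have ht := tendsto_measure_iInter_atTop (μ := P) (hnull n) (hanti n)
      ⟨0, measure_ne_top _ _⟩
    rw [hzero n] at ht
    exact (ht.eventually (gt_mem_nhds (he0 n))).exists
  choose m hm using hchoose
  refine ⟨⋂ n, D n (m n), ?_, ?_⟩
  · refine TotallyBounded.isCompact_of_isClosed ?_ (isClosed_iInter fun n => hDclosed n _)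
    refine Metric.totallyBounded_iff.2 fun r hr => ?_
    obtain ⟨n, hn⟩ := exists_nat_one_div_lt hr
    refine ⟨x '' (Finset.range (m n)), (Finset.finite_toSet _).image _, ?_⟩
    refine (iInter_subset _ n).trans ?_
    rw [biUnion_image]
    exact iUnion₂_mono fun i _ => Metric.closedBall_subset_ball hn
  · calc P {ω | ¬ fiber K ω ⊆ ⋂ n, D n (m n)}
        ≤ P (⋃ n, {ω | ¬ fiber K ω ⊆ D n (m n)}) := by
          refine measure_mono fun ω hω => ?_
          simpa [subset_iInter_iff] using hω
      _ ≤ ∑' n, P {ω | ¬ fiber K ω ⊆ D n (m n)} := measure_iUnion_le _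
      _ ≤ ∑' n, e n := ENNReal.tsum_le_tsum fun n => (hm n).le
      _ ≤ ε := hesum.le

/-! ### The implications (iii) ⇒ (ii) and (i) ⇒ (iii) -/

theorem subset_cthickening_of_semiDist_le {E : Type*} [MetricSpace E] {A B : Set E} {δ : ℝ}
    (h : semiDist A B ≤ ENNReal.ofReal δ) : A ⊆ Metric.cthickening δ B := fun a ha =>
  Metric.mem_cthickening_iff.2
    ((le_iSup₂ (f := fun a (_ : a ∈ A) => Metric.infEDist a B) a ha).trans h)

/-- For every `ε` there is a compact set whose neighbourhoods eventually contain the pullback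
images of every bounded closed set, up to probability `ε`. -/
def ContinuousRDS.HasAttractingCompacts {Ω : Type*} [MeasurableSpace Ω] {P : Measure Ω}
    {ϑ : MetricDynamicalSystem P} {E : Type*} [MetricSpace E] [MeasurableSpace E]
    (φ : ContinuousRDS ϑ E) : Prop :=
  ∀ ε : ℝ, 0 < ε → ∃ C : Set E, IsCompact C ∧
    ∀ δ : ℝ, 0 < δ → ∀ B : Set E, Bornology.IsBounded B → IsClosed B →
      ∃ T : ℝ≥0, 0 < T ∧
        1 - ε ≤ P.real {ω | (⋃ t ≥ T, φ.pullback t ω B) ⊆ Metric.cthickening δ C}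

namespace ContinuousRDS

variable {Ω : Type*} [MeasurableSpace Ω] {P : Measure Ω} {ϑ : MetricDynamicalSystem P}
  {E : Type*} [MetricSpace E] [MeasurableSpace E] (φ : ContinuousRDS ϑ E)

/-- The complement is the projection along the Polish space [0, ∞) × E of a measurable set. -/
theorem nullMeasurableSet_tail_subset [IsFiniteMeasure P] [CompleteSpace E]
    [SecondCountableTopology E] [BorelSpace E] (T : ℝ≥0) {B D : Set E} (hB : MeasurableSet B)
    (hD : MeasurableSet D) : NullMeasurableSet {ω | φ.tail T ω B ⊆ D} P := by
  have h1 : Measurable fun p : (ℝ≥0 × E) × Ω =>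
      φ.flow p.1.1 (ϑ.shift (-(p.1.1 : ℝ)) p.2) p.1.2 :=
    φ.measurable_pullbackMap.comp (measurable_fst.fst.prodMk
      (measurable_snd.prodMk measurable_fst.snd))
  have h2 : MeasurableSet (((fun p : (ℝ≥0 × E) × Ω => p.1.1) ⁻¹' Ici T) ∩
      (((fun p : (ℝ≥0 × E) × Ω => p.1.2) ⁻¹' B) ∩ ((fun p : (ℝ≥0 × E) × Ω =>
      φ.flow p.1.1 (ϑ.shift (-(p.1.1 : ℝ)) p.2) p.1.2) ⁻¹' Dᶜ))) :=
    (measurable_fst.fst measurableSet_Ici).inter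
      ((measurable_fst.snd hB).inter (h1 hD.compl))
  have h3 := (nullMeasurableSet_image_snd P h2).compl
  convert h3 using 1
  ext ω
  simp only [mem_ofPred_eq, subset_def, mem_tail, mem_compl_iff, mem_image, mem_inter_iff,
    mem_preimage, mem_Ici, Prod.exists]
  grind

theorem hasAttractingCompacts_of_randomSet [IsProbabilityMeasure P] [CompleteSpace E]
    [SecondCountableTopology E] [BorelSpace E] {K : Set (E × Ω)} (hK : MeasurableSet K)
    (hKc : ∀ᵐ ω ∂P, IsCompact (fiber K ω)) (hatt : φ.AttractsBounded (fiber K)) :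
    φ.HasAttractingCompacts := by
  intro ε hε
  obtain ⟨C, hC, hPC⟩ := exists_isCompact_fiber_subset P hK hKc (ε := ENNReal.ofReal (ε / 2))
    (by simpa using hε)
  refine ⟨C, hC, fun δ hδ B hB _ => ?_⟩
  -- The shift by one keeps the time positive. Attraction and tightness give the union probability
  -- at least 1 - ε/2, so some `S n` exceeds 1 - ε.
  let S : ℕ → Set Ω := fun n => {ω | φ.tail (n + 1 : ℕ) ω B ⊆ Metric.cthickening δ C}
  have hSmono : Monotone S := fun a b hab ω hω =>
    (φ.tail_anti (by gcongr) ω B).trans hω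
  have hcompl : P (⋃ n, S n)ᶜ ≤ ENNReal.ofReal (ε / 2) := by
    refine (measure_mono_ae ?_).trans hPC
    filter_upwards [hatt B hB] with ω hω hmem
    change ¬ fiber K ω ⊆ C
    intro hsub
    refine hmem ?_
    obtain ⟨T, hT⟩ := eventually_atTop.1
      (hω.eventually (ge_mem_nhds (ENNReal.ofReal_pos.2 hδ)))
    obtain ⟨n, hn⟩ := exists_nat_ge T
    refine mem_iUnion.2 ⟨n, ?_⟩
    change φ.tail _ ω B ⊆ _
    refine iUnion₂_subset fun t ht => ?_
    have hTt : T ≤ t := hn.trans (le_trans (by simp) ht)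
    exact (subset_cthickening_of_semiDist_le (hT t hTt)).trans
      (Metric.cthickening_subset_of_subset δ hsub)
  have hge : 1 - ε / 2 ≤ P.real (⋃ n, S n) := by
    have h1 : P.real univ ≤ P.real (⋃ n, S n) + P.real (⋃ n, S n)ᶜ := by
      rw [← union_compl_self (⋃ n, S n)]
      exact measureReal_union_le _ _
    have h2 : P.real (⋃ n, S n)ᶜ ≤ ε / 2 := ENNReal.toReal_le_of_le_ofReal (by positivity) hcompl
    rw [probReal_univ] at h1
    linarith
  have ht : Tendsto (fun n => P.real (S n)) atTop (𝓝 (P.real (⋃ n, S n))) :=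
    (ENNReal.tendsto_toReal (measure_ne_top _ _)).comp (tendsto_measure_iUnion_atTop hSmono)
  obtain ⟨n, hn⟩ := (ht.eventually (lt_mem_nhds (show 1 - ε < P.real (⋃ n, S n) by linarith))).exists
  exact ⟨(n + 1 : ℕ), by positivity, hn.le⟩

theorem IsStrongBAttractor.exists_randomSet [SecondCountableTopology E] [BorelSpace E]
    {φ : ContinuousRDS ϑ E} {A : Ω → Set E} (hA : φ.IsStrongBAttractor A) :
    ∃ K : Set (E × Ω), MeasurableSet K ∧ (∀ᵐ ω ∂P, IsCompact (fiber K ω)) ∧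
      φ.AttractsBounded (fiber K) :=
  ⟨{p | p.1 ∈ A p.2}, hA.isCompactRandomSet.measurableSet_graph,
    .of_forall hA.isCompactRandomSet.isCompact, hA.attracts⟩

end ContinuousRDS

/-! ### Measurability of infima over random sets -/

/-- The random set that equals `A` on `S` and is empty off `S`. -/
def restrictSet {Ω E : Type*} (S : Set Ω) (A : Ω → Set E) (ω : Ω) : Set E := {y | ω ∈ S ∧ y ∈ A ω}

theorem restrictSet_of_mem {Ω E : Type*} {S : Set Ω} {A : Ω → Set E} {ω : Ω} (h : ω ∈ S) :
    restrictSet S A ω = A ω := by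
  ext; simp [restrictSet, h]

theorem restrictSet_of_notMem {Ω E : Type*} {S : Set Ω} {A : Ω → Set E} {ω : Ω} (h : ω ∉ S) :
    restrictSet S A ω = ∅ := by
  ext; simp [restrictSet, h]

theorem measurable_infEDist_restrictSet {Ω E : Type*} [MeasurableSpace Ω] [PseudoEMetricSpace E]
    {S : Set Ω} (hS : MeasurableSet S) {A : Ω → Set E} {x : E} {f : Ω → ℝ≥0∞} (hf : Measurable f)
    (h : ∀ ω ∈ S, Metric.infEDist x (A ω) = f ω) :
    Measurable fun ω => Metric.infEDist x (restrictSet S A ω) := by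
  classical
  have h1 : (fun ω => Metric.infEDist x (restrictSet S A ω)) = S.piecewise f fun _ => ⊤ := by
    funext ω
    by_cases hω : ω ∈ S
    · rw [restrictSet_of_mem hω, piecewise_eq_of_mem _ _ _ hω, h ω hω]
    · rw [restrictSet_of_notMem hω, piecewise_eq_of_notMem _ _ _ hω, Metric.infEDist_empty]
  rw [h1]
  exact hf.piecewise hS measurable_const

/-- The infimum of a Carathéodory function over a random set is measurable as soon as the distance
functions of the random set from the points of a dense sequence are. -/
theorem measurable_iInf_randomSet {Ω E : Type*} [MeasurableSpace Ω] [PseudoMetricSpace E]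
    {x : ℕ → E} (hx : DenseRange x) {Z : Ω → Set E}
    (hZ : ∀ i, Measurable fun ω => Metric.infEDist (x i) (Z ω)) {h : Ω → E → ℝ≥0∞}
    (hcont : ∀ ω, Continuous (h ω)) (hmeas : ∀ y, Measurable fun ω => h ω y) :
    Measurable fun ω => ⨅ y ∈ Z ω, h ω y := by
  refine measurable_of_Iio fun c => ?_
  let r : ℕ → ℝ := fun k => 1 / (k + 1)
  let q : ℚ → ℝ≥0∞ := fun q => (Real.toNNReal q : ℝ≥0∞)
  -- A countable test: some small ball about a dense point meets `Z ω`, and `h ω` is at most a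
  -- rational level below `c` on the dense points of that ball, hence on all of it by continuity.
  have hset : (fun ω => ⨅ y ∈ Z ω, h ω y) ⁻¹' Iio c
      = ⋃ (i : ℕ) (k : ℕ) (p : ℚ) (_ : q p < c),
        {ω | Metric.infEDist (x i) (Z ω) < ENNReal.ofReal (r k)} ∩
        ⋂ (j : ℕ) (_ : x j ∈ Metric.ball (x i) (r k)), {ω | h ω (x j) ≤ q p} := by
    ext ω
    simp only [mem_preimage, mem_Iio, iInf_lt_iff, mem_iUnion, mem_inter_iff, mem_iInter,
      mem_ofPred_eq, exists_prop]
    constructor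
    · rintro ⟨y, hy, hyc⟩
      obtain ⟨p, -, hp1, hp2⟩ := ENNReal.lt_iff_exists_rat_btwn.1 hyc
      obtain ⟨ρ, hρ, hball⟩ := Metric.isOpen_iff.1 (isOpen_Iio.preimage (hcont ω)) y
        (show h ω y ∈ Iio (q p) from hp1)
      obtain ⟨k, hk⟩ := exists_nat_one_div_lt (half_pos hρ)
      obtain ⟨i, hi⟩ := hx.exists_dist_lt y (show 0 < r k from Nat.one_div_pos_of_nat)
      refine ⟨i, k, p, hp2, ?_, fun j hj => ?_⟩
      · refine (Metric.infEDist_le_edist_of_mem hy).trans_lt ?_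
        rw [edist_dist, dist_comm]
        exact (ENNReal.ofReal_lt_ofReal_iff Nat.one_div_pos_of_nat).2 hi
      · refine le_of_lt (hball (Metric.mem_ball.2 ?_))
        have h1 := dist_triangle (x j) (x i) y
        rw [dist_comm (x i) y] at h1
        have h2 := Metric.mem_ball.1 hj
        have h3 : r k < ρ / 2 := hk
        linarith
    · rintro ⟨i, k, p, hp, hik, hj⟩
      obtain ⟨z, hz, hzi⟩ := Metric.infEDist_lt_iff.1 hik
      refine ⟨z, hz, lt_of_le_of_lt ?_ hp⟩
      have hzb : z ∈ Metric.ball (x i) (r k) := by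
        rw [Metric.mem_ball, dist_comm]
        rw [edist_dist] at hzi
        exact (ENNReal.ofReal_lt_ofReal_iff Nat.one_div_pos_of_nat).1 hzi
      have hzc : z ∈ closure (Metric.ball (x i) (r k) ∩ range x) :=
        hx.open_subset_closure_inter Metric.isOpen_ball hzb
      refine closure_minimal ?_ (isClosed_Iic.preimage (hcont ω)) hzc
      rintro _ ⟨hb, j, rfl⟩
      exact hj j hb
  rw [hset]
  refine .iUnion fun i => .iUnion fun k => .iUnion fun p => .iUnion fun _ => .inter ?_ ?_
  · exact hZ i measurableSet_Iio
  · exact .iInter fun j => .iInter fun _ => hmeas (x j) measurableSet_Iic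

/-! ### The limit set and its deterministic properties -/

namespace ContinuousRDS

variable {Ω : Type*} [MeasurableSpace Ω] {P : Measure Ω} {ϑ : MetricDynamicalSystem P}
  {E : Type*} [MetricSpace E] [MeasurableSpace E] (φ : ContinuousRDS ϑ E) (x₀ : E)

/-- The set of those `ω` at which a single compact set pullback-attracts all balls about `x₀`. -/
def compactlyAttracted : Set Ω :=
  {ω | ∃ C : Set E, IsCompact C ∧ ∀ n : ℕ, φ.tailFilter ω (Metric.closedBall x₀ n) ≤ 𝓝ˢ C}

/-- The closure of the union of the pullback `ω`-limit sets of the balls about `x₀`. -/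
def limitSet (ω : Ω) : Set E :=
  closure (⋃ n : ℕ, clusterSet (φ.tailFilter ω (Metric.closedBall x₀ n)))

variable {φ x₀} {ω : Ω}

theorem shift_mem_compactlyAttracted (h : ω ∈ φ.compactlyAttracted x₀) (s : ℝ≥0) :
    ϑ.shift s ω ∈ φ.compactlyAttracted x₀ := by
  obtain ⟨C, hC, hn⟩ := h
  refine ⟨_, hC.image (φ.continuous_flow s ω), fun n => ?_⟩
  rw [φ.tailFilter_shift]
  exact map_le_nhdsSet_image (hn n) (φ.continuous_flow s ω)

theorem isCompact_limitSet (h : ω ∈ φ.compactlyAttracted x₀) : IsCompact (φ.limitSet x₀ ω) := by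
  obtain ⟨C, hC, hn⟩ := h
  exact hC.of_isClosed_subset isClosed_closure (closure_minimal
    (iUnion_subset fun n => clusterSet_subset_of_le_nhdsSet hC (hn n)) hC.isClosed)

theorem image_flow_limitSet (h : ω ∈ φ.compactlyAttracted x₀) (s : ℝ≥0) :
    φ.flow s ω '' φ.limitSet x₀ ω = φ.limitSet x₀ (ϑ.shift s ω) := by
  have hcomp := isCompact_limitSet h
  obtain ⟨C, hC, hn⟩ := h
  have hf := φ.continuous_flow s ω
  unfold limitSet
  rw [image_closure_of_isCompact hcomp hf.continuousOn, image_iUnion]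
  congr 1
  exact iUnion_congr fun n => by rw [φ.tailFilter_shift, clusterSet_map hC (hn n) hf]

theorem tendsto_semiDist_limitSet (h : ω ∈ φ.compactlyAttracted x₀) {B : Set E}
    (hB : Bornology.IsBounded B) :
    Tendsto (fun t : ℝ≥0 => semiDist (φ.pullback t ω B) (φ.limitSet x₀ ω)) atTop (𝓝 0) := by
  obtain ⟨C, hC, hn⟩ := h
  obtain ⟨R, hR⟩ := hB.subset_closedBall x₀
  obtain ⟨n, hRn⟩ := exists_nat_ge R
  have hBn : B ⊆ Metric.closedBall x₀ n := hR.trans (Metric.closedBall_subset_closedBall hRn)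
  refine ENNReal.tendsto_nhds_zero.2 fun ε hε => ?_
  have hopen : IsOpen {z | Metric.infEDist z (φ.limitSet x₀ ω) < ε} :=
    isOpen_Iio.preimage Metric.continuous_infEDist
  have hsub : clusterSet (φ.tailFilter ω (Metric.closedBall x₀ n))
      ⊆ {z | Metric.infEDist z (φ.limitSet x₀ ω) < ε} := by
    intro z hz
    have h1 : z ∈ φ.limitSet x₀ ω := subset_closure (mem_iUnion.2 ⟨n, hz⟩)
    simpa [Metric.infEDist_zero_of_mem h1] using hε
  obtain ⟨T, -, hT⟩ := (φ.hasBasis_tailFilter ω _).mem_iff.1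
    (le_nhdsSet_clusterSet hC (hn n) (hopen.mem_nhdsSet.2 hsub))
  filter_upwards [eventually_ge_atTop T] with t ht
  exact iSup₂_le fun y hy =>
    le_of_lt (hT (φ.tail_mono T ω hBn (φ.pullback_subset_tail ht ω B hy)))

/-- This reduces measurability to the tails by countable operations; integer times suffice because
tails decrease. If all cluster points are farther than `c'` from `x`, so is some tail. -/
theorem infEDist_limitSet (h : ω ∈ φ.compactlyAttracted x₀) (x : E) :
    Metric.infEDist x (φ.limitSet x₀ ω)
      = ⨅ n : ℕ, ⨆ m : ℕ, Metric.infEDist x (φ.tail m ω (Metric.closedBall x₀ n)) := by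
  obtain ⟨C, hC, hn⟩ := h
  rw [limitSet, Metric.infEDist_closure, Metric.infEDist_iUnion]
  refine iInf_congr fun n => le_antisymm ?_ (iSup_le fun m => ?_)
  · refine le_of_forall_lt fun c hc => ?_
    obtain ⟨c', hcc', hc'⟩ := exists_between hc
    have hopen : IsOpen {z | c' < edist x z} := isOpen_lt continuous_const (by fun_prop)
    have hsub : clusterSet (φ.tailFilter ω (Metric.closedBall x₀ n)) ⊆ {z | c' < edist x z} :=
      fun z hz => hc'.trans_le (Metric.infEDist_le_edist_of_mem hz)
    obtain ⟨T, -, hT⟩ := (φ.hasBasis_tailFilter ω _).mem_iff.1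
      (le_nhdsSet_clusterSet hC (hn n) (hopen.mem_nhdsSet.2 hsub))
    obtain ⟨m, hm⟩ := exists_nat_ge T
    refine hcc'.trans_le (le_trans ?_ (le_iSup _ m))
    exact Metric.le_infEDist.2 fun y hy => le_of_lt (hT (φ.tail_anti hm ω _ hy))
  · rw [← Metric.infEDist_closure (s := φ.tail _ _ _)]
    refine Metric.infEDist_anti fun z hz => ?_
    exact mem_closure_iff_clusterPt.2 ((show ClusterPt z _ from hz).mono
      (le_principal_iff.2 (φ.tail_mem_tailFilter _ _ _)))

/-- If `H` is a measurable set of compactly attracted points on which the distance functions of the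
limit sets are measurable, then they are measurable on the invariant set `ϑ.aeOrbit H`. -/
theorem measurable_infEDist_restrictSet_aeOrbit [SecondCountableTopology E] [BorelSpace E]
    {H : Set Ω} (hH : MeasurableSet H)
    (hHG : H ⊆ φ.compactlyAttracted x₀) {d : ℕ → E} (hd : DenseRange d)
    (hmeas : ∀ i, Measurable fun ω => Metric.infEDist (d i) (restrictSet H (φ.limitSet x₀) ω))
    (x : E) :
    Measurable fun ω => Metric.infEDist x (restrictSet (ϑ.aeOrbit H) (φ.limitSet x₀) ω) := by
  have hshift : Measurable fun p : Ω × ℝ => ϑ.shift (-p.2) p.1 :=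
    ϑ.measurable_shift.comp (measurable_snd.neg.prodMk measurable_fst)
  let g : Ω × ℝ → ℝ≥0∞ := fun p =>
    ⨅ y ∈ restrictSet H (φ.limitSet x₀) (ϑ.shift (-p.2) p.1),
      edist x (φ.flow p.2.toNNReal (ϑ.shift (-p.2) p.1) y)
  have hg : Measurable g := by
    refine measurable_iInf_randomSet hd (fun i => (hmeas i).comp hshift)
      (fun p => continuous_const.edist (φ.continuous_flow _ _)) fun y => ?_
    exact measurable_const.edist (φ.measurable_flow.comp
      ((measurable_real_toNNReal.comp measurable_snd).prodMk (hshift.prodMk measurable_const)))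
  -- The integrand is almost everywhere constant in `t` when `ω` lies in `aeOrbit H`, so averaging
  -- over an interval of length one returns the distance itself.
  have hint : Measurable fun ω => ∫⁻ t in Icc (0 : ℝ) 1, g (ω, t) := hg.lintegral_prod_right'
  refine measurable_infEDist_restrictSet (ϑ.measurableSet_aeOrbit hH) hint fun ω hω => ?_
  have hconst : ∀ᵐ t : ℝ, t ∈ Icc (0 : ℝ) 1 → g (ω, t) = Metric.infEDist x (φ.limitSet x₀ ω) := by
    filter_upwards [ϑ.ae_shift_neg_mem hω] with t ht ht01
    have h1 := image_flow_limitSet (hHG ht) t.toNNReal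
    rw [Real.coe_toNNReal t ht01.1, ϑ.shift_shift_neg] at h1
    rw [← h1, Metric.infEDist, iInf_image]
    simp only [g, restrictSet_of_mem ht]
  rw [setLIntegral_congr_fun_ae measurableSet_Icc hconst]
  simp

/-! ### Almost sure compact attraction and the attractor -/

variable [IsProbabilityMeasure P] [CompleteSpace E] [SecondCountableTopology E] [BorelSpace E]

theorem aemeasurable_infEDist_tail (T : ℝ≥0) {B : Set E} (hB : MeasurableSet B) (x : E) :
    AEMeasurable (fun ω => Metric.infEDist x (φ.tail T ω B)) P := by
  have h1 : Measurable (fun ω : NullMeasurableSpace Ω P => Metric.infEDist x (φ.tail T ω B)) := by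
    refine measurable_of_Ici fun c => ?_
    have h2 := φ.nullMeasurableSet_tail_subset (P := P) T hB
      (D := {y | c ≤ edist x y}) (measurableSet_le measurable_const (by fun_prop))
    have h3 : (fun ω => Metric.infEDist x (φ.tail T ω B)) ⁻¹' Ici c
        = {ω | φ.tail T ω B ⊆ {y | c ≤ edist x y}} := by
      ext ω
      simp [Metric.le_infEDist, subset_def]
    exact h3 ▸ h2
  exact NullMeasurable.aemeasurable h1

theorem aemeasurable_infEDist_limitSet (hae : ∀ᵐ ω ∂P, ω ∈ φ.compactlyAttracted x₀) (x : E) :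
    AEMeasurable (fun ω => Metric.infEDist x (φ.limitSet x₀ ω)) P := by
  have h1 : AEMeasurable (fun ω => ⨅ n : ℕ, ⨆ m : ℕ,
      Metric.infEDist x (φ.tail m ω (Metric.closedBall x₀ n))) P :=
    .iInf fun n => .iSup fun m =>
      aemeasurable_infEDist_tail m Metric.isClosed_closedBall.measurableSet x
  refine h1.congr ?_
  filter_upwards [hae] with ω hω using (infEDist_limitSet hω x).symm

theorem HasAttractingCompacts.ae_mem_compactlyAttracted (h : φ.HasAttractingCompacts) (x₀ : E) :
    ∀ᵐ ω ∂P, ω ∈ φ.compactlyAttracted x₀ := by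
  refine le_antisymm (ENNReal.le_of_forall_pos_le_add fun ε hε _ => ?_) zero_le
  rw [zero_add]
  obtain ⟨C, hC, hCB⟩ := h ε hε
  -- Tying the radius of the ball and the width of the neighbourhood to one index makes `G`
  -- decreasing, so the bound `ε` on each complement passes to their union.
  let G : ℕ → Set Ω := fun n => ⋃ m : ℕ,
    {ω | φ.tail m ω (Metric.closedBall x₀ n) ⊆ Metric.cthickening (1 / (n + 1)) C}
  have hGnull : ∀ n, NullMeasurableSet (G n) P := fun n => .iUnion fun m =>
    φ.nullMeasurableSet_tail_subset _ Metric.isClosed_closedBall.measurableSet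
      Metric.isClosed_cthickening.measurableSet
  have hGmono : Monotone fun n => (G n)ᶜ := by
    intro a b hab
    refine compl_subset_compl.2 (iUnion_mono fun m ω hω => ?_)
    refine (φ.tail_mono _ ω (Metric.closedBall_subset_closedBall (by gcongr))).trans
      (Set.Subset.trans hω (Metric.cthickening_mono ?_ C))
    exact Nat.one_div_le_one_div hab
  have hGP : ∀ n, P (G n)ᶜ ≤ ε := by
    intro n
    obtain ⟨T, -, hT⟩ := hCB (1 / (n + 1)) Nat.one_div_pos_of_nat (Metric.closedBall x₀ n)
      Metric.isBounded_closedBall Metric.isClosed_closedBall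
    obtain ⟨m, hm⟩ := exists_nat_ge T
    have h1 : 1 - (ε : ℝ) ≤ P.real (G n) := hT.trans (measureReal_mono fun ω hω =>
      mem_iUnion.2 ⟨m, (φ.tail_anti hm ω _).trans hω⟩)
    rw [prob_compl_eq_one_sub₀ (hGnull n), tsub_le_iff_right]
    have h2 : (1 : ℝ) ≤ (ε + P (G n)).toReal := by
      rw [ENNReal.toReal_add (by simp) (by finiteness), ENNReal.coe_toReal]
      change 1 - (ε : ℝ) ≤ (P (G n)).toReal at h1
      linarith
    have h3 := (ENNReal.ofReal_le_iff_le_toReal (by finiteness)).2 h2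
    simpa using h3
  have hsub : {ω | ω ∉ φ.compactlyAttracted x₀} ⊆ ⋃ n, (G n)ᶜ := by
    intro ω hω
    by_contra hcon
    simp only [mem_iUnion, mem_compl_iff, not_exists, not_not] at hcon
    refine hω ⟨C, hC, fun n U hU => ?_⟩
    obtain ⟨V, ⟨hVo, hCV⟩, hVU⟩ := (hasBasis_nhdsSet C).mem_iff.1 hU
    obtain ⟨δ, hδ, hδV⟩ := hC.exists_cthickening_subset_open hVo hCV
    obtain ⟨k, hk⟩ := exists_nat_one_div_lt hδ
    obtain ⟨m, hm⟩ := mem_iUnion.1 (hcon (max n k))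
    refine mem_of_superset (φ.tail_mem_tailFilter m ω _) ?_
    refine (φ.tail_mono _ ω (Metric.closedBall_subset_closedBall
      (by exact_mod_cast le_max_left n k))).trans (Set.Subset.trans hm
        ((Metric.cthickening_mono ?_ C).trans (hδV.trans hVU)))
    exact (Nat.one_div_le_one_div (le_max_right n k)).trans hk.le
  exact (measure_mono hsub).trans (le_of_tendsto (tendsto_measure_iUnion_atTop hGmono)
    (Eventually.of_forall hGP))

theorem HasAttractingCompacts.exists_isStrongBAttractor (h : φ.HasAttractingCompacts) :
    ∃ A : Ω → Set E, φ.IsStrongBAttractor A := by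
  rcases isEmpty_or_nonempty E with hE | ⟨⟨x₀⟩⟩
  · refine ⟨fun _ => ∅, ⟨fun _ => isCompact_empty, fun x => (hE.false x).elim⟩, ?_, ?_⟩
    · simp
    · refine fun B _ => .of_forall fun ω => ?_
      simp [semiDist]
  have hne : Nonempty E := ⟨x₀⟩
  have hae := h.ae_mem_compactlyAttracted x₀
  let d := TopologicalSpace.denseSeq E
  have hf := fun i => aemeasurable_infEDist_limitSet hae (d i)
  have hgood : ∀ᵐ ω ∂P, ω ∈ φ.compactlyAttracted x₀ ∧
      ∀ i, Metric.infEDist (d i) (φ.limitSet x₀ ω) = (hf i).mk _ ω :=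
    hae.and (ae_all_iff.2 fun i => (hf i).ae_eq_mk)
  -- On `H` the distances from the dense points coincide with measurable versions, so they are
  -- measurable there without completion.
  obtain ⟨H, hHae, hHm, hH⟩ := hgood.exists_measurable_mem
  have hHG : H ⊆ φ.compactlyAttracted x₀ := fun ω hω => (hH ω hω).1
  -- Compact attraction propagates forward in time, and the orbit has visited `H` at some time in
  -- the past.
  have hOG : ϑ.aeOrbit H ⊆ φ.compactlyAttracted x₀ := by
    intro ω hω
    obtain ⟨t, ht⟩ := ϑ.exists_nonneg_shift_neg_mem hω
    simpa only [ϑ.shift_shift_neg] using shift_mem_compactlyAttracted (hHG ht) t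
  have hOae : ∀ᵐ ω ∂P, ω ∈ ϑ.aeOrbit H := ϑ.ae_mem_aeOrbit hHm hHae
  refine ⟨restrictSet (ϑ.aeOrbit H) (φ.limitSet x₀), ⟨fun ω => ?_, fun x => ?_⟩, ?_, ?_⟩
  · by_cases hω : ω ∈ ϑ.aeOrbit H
    · rw [restrictSet_of_mem hω]
      exact isCompact_limitSet (hOG hω)
    · rw [restrictSet_of_notMem hω]
      exact isCompact_empty
  · exact measurable_infEDist_restrictSet_aeOrbit hHm hHG (TopologicalSpace.denseRange_denseSeq E)
      (fun i => measurable_infEDist_restrictSet hHm (hf i).measurable_mk fun ω hω => (hH ω hω).2 i) x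
  · filter_upwards [hOae] with ω hω t
    rw [restrictSet_of_mem hω, restrictSet_of_mem (ϑ.shift_mem_aeOrbit hω t)]
    exact image_flow_limitSet (hOG hω) t
  · intro B hB
    filter_upwards [hOae] with ω hω
    rw [restrictSet_of_mem hω]
    exact tendsto_semiDist_limitSet (hOG hω) hB

end ContinuousRDS

end RandomAttractors

theorem theorem1 {Ω : Type*} [MeasurableSpace Ω] (P : Measure Ω) [IsProbabilityMeasure P]
    (ϑ : RandomAttractors.MetricDynamicalSystem P)
    {E : Type*} [MetricSpace E] [CompleteSpace E] [SecondCountableTopology E]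
    [MeasurableSpace E] [BorelSpace E]
    (φ : RandomAttractors.ContinuousRDS ϑ E) :
    List.TFAE [
      ∃ A : Ω → Set E, φ.IsStrongBAttractor A,
      ∀ ε : ℝ, 0 < ε → ∃ C : Set E, IsCompact C ∧
        ∀ δ : ℝ, 0 < δ → ∀ B : Set E, Bornology.IsBounded B → IsClosed B →
          ∃ T : ℝ≥0, 0 < T ∧
            1 - ε ≤ P.real {ω | (⋃ t ≥ T, φ.pullback t ω B) ⊆ Metric.cthickening δ C},
      ∃ K : Set (E × Ω), MeasurableSet K ∧
        (∀ᵐ ω ∂P, IsCompact (RandomAttractors.fiber K ω)) ∧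
        φ.AttractsBounded (RandomAttractors.fiber K)] := by
  tfae_have 1 → 3 := fun ⟨_, hA⟩ => hA.exists_randomSet
  tfae_have 3 → 2 := fun ⟨_, hK, hKc, hatt⟩ => φ.hasAttractingCompacts_of_randomSet hK hKc hatt
  tfae_have 2 → 1 := fun h =>
    RandomAttractors.ContinuousRDS.HasAttractingCompacts.exists_isStrongBAttractor h
  tfae_finish
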